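/- For $x\in[0,1]$ let $h(x)=-x\log_2x-(1-x)\log_2(1-x)$ (with $0\log_2 0=0$), and put $c_{\max}=3\,h\!\left(\tfrac12+\tfrac{\sqrt5}{6}\right)$. For a bipartite pure state $|\phi\rangle_{AB}$ (a unit vector) with reduced state $\rho_A=\mathrm{Tr}_B|\phi\rangle\langle\phi|$ let $E(|\phi\rangle)=-\mathrm{Tr}\,\rho_A\log_2\rho_A$ and $C(|\phi\rangle)=\sqrt{2(1-\mathrm{Tr}\,\rho_A^2)}$. For a bipartite mixed state $\rho$, the entanglement of formation $E(\rho)$ and the concurrence $C(\rho)$ are the minima of $\sum_ip_iE(|\phi_i\rangle)$ and of $\sum_ip_iC(|\phi_i\rangle)$, respectively, over all finite decompositions $\rho=\sum_ip_i|\phi_i\rangle\langle\phi_i|$ into pure states with $p_i\ge0$, $\sum_ip_i=1$. For a three-qubit state $\rho$ let $\rho_{AB}$, $\rho_{AC}$, $\rho_{BC}$ be its two-qubit reduced states and $C_{AB}=C(\rho_{AB})$, $C_{AC}=C(\rho_{AC})$, $C_{BC}=C(\rho_{BC})$. 1. Every three-qubit pure state satisfies $E(\rho_{AB})+E(\rho_{AC})+E(\rho_{BC})\le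 c_{\max}$. 2. The W state $|W\rangle=\frac1{\sqrt3}(|001\rangle+|010\rangle+|100\rangle)$ satisfies $E(\rho_{AB})+E(\rho_{AC})+E(\rho_{BC})=c_{\max}$. 3. A three-qubit pure state attains equality in 1 if and only if $C_{AB}^2=C_{AC}^2=C_{BC}^2=\tfrac49$. 4. Every three-qubit mixed state (density operator on $\mathbb C^2\otimes\mathbb C^2\otimes\mathbb C^2$) satisfies $E(\rho_{AB})+E(\rho_{AC})+E(\rho_{BC})\le c_{\max}$. -/

import Mathlib

noncomputable section

namespace QState

open Matrix
open scoped ComplexOrder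

/-- The state vector `ψ` has norm one. -/
def IsUnitVec {X : Type*} [Fintype X] (ψ : X → ℂ) : Prop :=
  ∑ x, ‖ψ x‖ ^ 2 = 1

/-- The rank-one operator `|ψ⟩⟨ψ|`. -/
def proj {X : Type*} (ψ : X → ℂ) : Matrix X X ℂ :=
  vecMulVec ψ (star ψ)

/-- Density operators: positive semidefinite of trace one. -/
def IsDensity {X : Type*} [Fintype X] (ρ : Matrix X X ℂ) : Prop :=
  ρ.PosSemidef ∧ ρ.trace = 1

/-- The partial trace of an operator on `A ⊗ B` over `B`. -/
def traceOutSnd {A B : Type*} [Fintype B] (ρ : Matrix (A × B) (A × B) ℂ) : Matrix A A ℂ :=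
  Matrix.of fun a a' => ∑ b, ρ (a, b) (a', b)

/-- The reduced state `ρ_A` of the bipartite pure state `ψ`. -/
def reduced {A B : Type*} [Fintype B] (ψ : A × B → ℂ) : Matrix A A ℂ :=
  traceOutSnd (proj ψ)

theorem reduced_isHermitian {A B : Type*} [Fintype B] (ψ : A × B → ℂ) :
    (reduced ψ).IsHermitian := by
  ext a a'
  simp [reduced, traceOutSnd, proj, vecMulVec, mul_comm]

/-- The von Neumann entropy `-∑ λᵢ log₂ λᵢ`, over the eigenvalues with multiplicity. -/
def vonNeumannEntropy {X : Type*} [Fintype X] [DecidableEq X] (ρ : Matrix X X ℂ)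
    (hρ : ρ.IsHermitian) : ℝ :=
  -∑ i, hρ.eigenvalues i * Real.logb 2 (hρ.eigenvalues i)

/-- The entanglement of formation of a bipartite pure state. -/
def pureEoF {A B : Type*} [Fintype A] [DecidableEq A] [Fintype B] (ψ : A × B → ℂ) : ℝ :=
  vonNeumannEntropy (reduced ψ) (reduced_isHermitian ψ)

/-- The concurrence `√(2 (1 - Tr ρ_A²))` of a bipartite pure state. -/
def pureConcurrence {A B : Type*} [Fintype A] [Fintype B] (ψ : A × B → ℂ) : ℝ :=
  Real.sqrt (2 * (1 - (reduced ψ * reduced ψ).trace.re))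

/-- `ρ = ∑ pᵢ |φᵢ⟩⟨φᵢ|`, a convex combination of finitely many pure states. -/
def IsDecomposition {X : Type*} [Fintype X] (ρ : Matrix X X ℂ) {n : ℕ}
    (p : Fin n → ℝ) (φ : Fin n → X → ℂ) : Prop :=
  (∀ i, 0 ≤ p i) ∧ ∑ i, p i = 1 ∧ (∀ i, IsUnitVec (φ i)) ∧
    ρ = ∑ i, (p i : ℂ) • proj (φ i)

/-- The convex roof of a function `F` of pure states. -/
def convexRoof {X : Type*} [Fintype X] (F : (X → ℂ) → ℝ) (ρ : Matrix X X ℂ) : ℝ :=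
  sInf {x : ℝ | ∃ (n : ℕ) (p : Fin n → ℝ) (φ : Fin n → X → ℂ),
    IsDecomposition ρ p φ ∧ x = ∑ i, p i * F (φ i)}

/-- The entanglement of formation of a bipartite state. -/
def eof {A B : Type*} [Fintype A] [DecidableEq A] [Fintype B]
    (ρ : Matrix (A × B) (A × B) ℂ) : ℝ :=
  convexRoof pureEoF ρ

/-- The concurrence of a bipartite state. -/
def concurrence {A B : Type*} [Fintype A] [Fintype B]
    (ρ : Matrix (A × B) (A × B) ℂ) : ℝ :=
  convexRoof pureConcurrence ρ

/-- Index set of the computational basis of two qubits. -/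
abbrev Idx2 : Type := Fin 2 × Fin 2

/-- Index set of the computational basis of three qubits, ordered `A`, `B`, `C`. -/
abbrev Idx3 : Type := Fin 2 × Fin 2 × Fin 2

/-- `ρ_AB = Tr_C ρ`. -/
def margAB (ρ : Matrix Idx3 Idx3 ℂ) : Matrix Idx2 Idx2 ℂ :=
  Matrix.of fun i j => ∑ c, ρ (i.1, i.2, c) (j.1, j.2, c)

/-- `ρ_AC = Tr_B ρ`. -/
def margAC (ρ : Matrix Idx3 Idx3 ℂ) : Matrix Idx2 Idx2 ℂ :=
  Matrix.of fun i j => ∑ b, ρ (i.1, b, i.2) (j.1, b, j.2)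

/-- `ρ_BC = Tr_A ρ`. -/
def margBC (ρ : Matrix Idx3 Idx3 ℂ) : Matrix Idx2 Idx2 ℂ :=
  Matrix.of fun i j => ∑ a, ρ (a, i.1, i.2) (a, j.1, j.2)

/-- `E(ρ_AB) + E(ρ_AC) + E(ρ_BC)`. -/
def eofSum (ρ : Matrix Idx3 Idx3 ℂ) : ℝ :=
  eof (margAB ρ) + eof (margAC ρ) + eof (margBC ρ)

/-- The basis vector `|abc⟩`. -/
def ket (a b c : Fin 2) : Idx3 → ℂ :=
  Pi.single (a, b, c) 1

/-- The W state `(|001⟩ + |010⟩ + |100⟩) / √3`. -/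
def wState : Idx3 → ℂ :=
  ((1 / Real.sqrt 3 : ℝ) : ℂ) • (ket 0 0 1 + ket 0 1 0 + ket 1 0 0)

/-- The binary entropy function in bits. -/
def h (x : ℝ) : ℝ :=
  -x * Real.logb 2 x - (1 - x) * Real.logb 2 (1 - x)

/-- The constant `3 h(1/2 + √5/6)`. -/
def cMax : ℝ :=
  3 * h (1 / 2 + Real.sqrt 5 / 6)

end QState

end

/-! Tracing one qubit out of a pure state leaves `proj v + proj w`, with `v`, `w` the slices along
the traced qubit. Let τ be the symmetric 2×2 Gram matrix of `detForm` on the pair. A unitary mixing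
of `v`, `w` leaves the state fixed and sends τ to UτUᵀ, so `sqConcurrence`, the squared difference
of the singular values of τ, is an invariant. Choosing the mixing so that `v` becomes a product
vector reduces it to |`detForm w w`|². This normal form gives the rank-two case of Wootters'
theorem: some decomposition has all its concurrences equal to the square root of the invariant
(`exists_isDecomposition`), and no decomposition has a smaller average
(`IsDecomposition.sqrt_sqConcurrence_le`).

Let f be `concurrenceEntropy`. Then E ≤ f(C) for each pair. As a function of C², f is strictly
concave, hence lies below its tangent at C² = 4/9; three such bounds add up to `cMax` as soon as the
squared concurrences sum to at most 4/3. For that (`sum_sqConcurrence_le`), the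
Coffman–Kundu–Wootters identity bounds C_AB² + C_AC² by 4 det ρ_A. In the normal form for BC, with p
the weight of `w`, this is at most 4p(1 - p), while C_BC² ≤ p², and 4p - 3p² ≤ 4/3.

Strictness of the tangent bound forces all three values to be 4/9 at equality. Conversely f is
convex in C, so an average concurrence of at least 2/3 gives E ≥ f(2/3) (`le_eof`). For mixed
states, decompositions of the marginals of the eigenvectors are concatenated. -/

noncomputable section

namespace QState

/-! ### Binary entropy as a function of the concurrence -/

section BinaryEntropy

open Real Set

/-- The function `log ((1 + s) / (1 - s))`, twice the inverse hyperbolic tangent. -/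
def logRatio (s : ℝ) : ℝ := log (1 + s) - log (1 - s)

theorem hasDerivAt_logRatio {s : ℝ} (h0 : 0 < s) (h1 : s < 1) :
    HasDerivAt logRatio (2 / (1 - s ^ 2)) s := by
  have ha : HasDerivAt (fun x : ℝ => log (1 + x)) (1 / (1 + s)) s :=
    ((hasDerivAt_id s).const_add 1).log (by simp; linarith)
  have hb : HasDerivAt (fun x : ℝ => log (1 - x)) (-1 / (1 - s)) s :=
    ((hasDerivAt_id s).const_sub 1).log (by simp; linarith)
  have h2 : (1 + s) ≠ 0 := by linarith
  have h3 : (1 - s) ≠ 0 := by linarith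
  have h4 : 1 - s ^ 2 ≠ 0 := by nlinarith
  refine (ha.sub hb).congr_deriv ?_
  field_simp
  ring

theorem two_mul_lt_logRatio {s : ℝ} (h0 : 0 < s) (h1 : s < 1) : 2 * s < logRatio s := by
  have h := hasSum_log_sub_log_of_abs_lt_one (abs_lt.2 ⟨by linarith, h1⟩)
  have := sum_le_hasSum (Finset.range 2) (fun i _ => by positivity) h
  simp only [Finset.sum_range_succ, Finset.sum_range_zero] at this
  norm_num at this
  have h3 : 0 < s ^ 3 := by positivity
  rw [logRatio]
  linarith

/-- `logRatio s / s` has the power series ∑ 2 s^(2k) / (2k + 1), which increases term by term,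
strictly from k = 1 on. -/
theorem mul_logRatio_lt {s t : ℝ} (h0 : 0 < s) (hst : s < t) (h1 : t < 1) :
    t * logRatio s < s * logRatio t := by
  have hs := (hasSum_log_sub_log_of_abs_lt_one
    (abs_lt.2 ⟨by linarith, hst.trans h1⟩ : |s| < 1)).mul_left t
  have ht := (hasSum_log_sub_log_of_abs_lt_one
    (abs_lt.2 ⟨by linarith, h1⟩ : |t| < 1)).mul_left s
  have ht0 : 0 < t := h0.trans hst
  have e : ∀ (k : ℕ) (x y : ℝ), x * (2 * (1 / (2 * (k : ℝ) + 1)) * y ^ (2 * k + 1)) =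
      (2 * (1 / (2 * (k : ℝ) + 1)) * (x * y)) * y ^ (2 * k) := fun k x y => by ring
  refine hasSum_lt (i := 1) (fun k => ?_) ?_ hs ht
  · rw [e, e, mul_comm s t]
    gcongr
  · rw [e, e, mul_comm s t]
    gcongr

/-- The derivative of the binary entropy with respect to the concurrence is half of this. -/
def concurrenceSlope (s : ℝ) : ℝ := logRatio s * √(1 - s ^ 2) / s

theorem antitoneOn_concurrenceSlope : AntitoneOn concurrenceSlope (Ioo 0 1) := by
  have hd : ∀ s ∈ Ioo (0 : ℝ) 1, HasDerivAt concurrenceSlope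
      ((2 * s - logRatio s) / (√(1 - s ^ 2) * s ^ 2)) s := by
    rintro s ⟨h0, h1⟩
    have hp : 0 < 1 - s ^ 2 := by nlinarith
    have hr : HasDerivAt (fun x : ℝ => √(1 - x ^ 2)) (-(2 * s) / (2 * √(1 - s ^ 2))) s := by
      have := ((hasDerivAt_pow 2 s).const_sub 1).sqrt hp.ne'
      simpa using this
    have := ((hasDerivAt_logRatio h0 h1).mul hr).div (hasDerivAt_id s) h0.ne'
    refine this.congr_deriv ?_
    have hq : √(1 - s ^ 2) ≠ 0 := (Real.sqrt_pos.2 hp).ne'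
    have hsq : √(1 - s ^ 2) ^ 2 = 1 - s ^ 2 := Real.sq_sqrt hp.le
    have e2 : 2 / (1 - s ^ 2) = 2 / √(1 - s ^ 2) ^ 2 := by rw [hsq]
    simp only [Pi.mul_apply, id]
    rw [e2]
    field_simp
    rw [hsq]
    ring
  refine antitoneOn_of_deriv_nonpos (convex_Ioo 0 1)
    (fun s hs => (hd s hs).continuousAt.continuousWithinAt)
    (fun s hs => (hd s (interior_subset hs)).differentiableAt.differentiableWithinAt) ?_
  intro s hs
  rw [interior_Ioo] at hs
  rw [(hd s hs).deriv]
  exact div_nonpos_of_nonpos_of_nonneg (by linarith [two_mul_lt_logRatio hs.1 hs.2])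
    (by positivity)

theorem hasDerivAt_binEntropy_half {s : ℝ} (h0 : 0 < s) (h1 : s < 1) :
    HasDerivAt (fun x => binEntropy ((1 + x) / 2)) (-logRatio s / 2) s := by
  have h := (hasDerivAt_binEntropy (p := (1 + s) / 2) (by linarith) (by linarith)).comp s
    (((hasDerivAt_id s).const_add 1).div_const 2)
  refine h.congr_deriv ?_
  rw [show 1 - (1 + s) / 2 = (1 - s) / 2 by ring, log_div (by linarith) two_ne_zero,
    log_div (by linarith) two_ne_zero, logRatio]
  ring

/-- The tangent bound in the variable s², where s² = 1 - C²: the derivative there is -`logRatio s /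
(4 * s)`, strictly decreasing by `mul_logRatio_lt`. Hence the entropy corrected by its tangent slope
has its strict maximum at `t`. -/
theorem binEntropy_half_lt {s t : ℝ} (ht0 : 0 < t) (ht1 : t < 1) (hs0 : 0 ≤ s) (hs1 : s ≤ 1)
    (hne : s ≠ t) :
    binEntropy ((1 + s) / 2) + logRatio t / (4 * t) * s ^ 2 <
      binEntropy ((1 + t) / 2) + logRatio t / (4 * t) * t ^ 2 := by
  set K : ℝ → ℝ := fun x => binEntropy ((1 + x) / 2) + logRatio t / (4 * t) * x ^ 2 with hK
  have hd : ∀ x ∈ Ioo (0 : ℝ) 1,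
      HasDerivAt K ((x * logRatio t - t * logRatio x) / (2 * t)) x := by
    rintro x ⟨h0, h1⟩
    have := (hasDerivAt_binEntropy_half h0 h1).add
      ((hasDerivAt_pow 2 x).const_mul (logRatio t / (4 * t)))
    refine this.congr_deriv ?_
    field_simp
    push_cast
    ring
  have hc : Continuous K := by
    have := binEntropy_continuous
    fun_prop
  rcases lt_or_gt_of_ne hne with h | h
  · have : StrictMonoOn K (Icc 0 t) := by
      refine strictMonoOn_of_deriv_pos (convex_Icc 0 t) hc.continuousOn ?_
      intro x hx
      rw [interior_Icc] at hx
      rw [(hd x ⟨hx.1, hx.2.trans ht1⟩).deriv]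
      exact div_pos (by linarith [mul_logRatio_lt hx.1 hx.2 ht1]) (by linarith)
    exact this ⟨hs0, h.le⟩ ⟨ht0.le, le_rfl⟩ h
  · have : StrictAntiOn K (Icc t 1) := by
      refine strictAntiOn_of_deriv_neg (convex_Icc t 1) hc.continuousOn ?_
      intro x hx
      rw [interior_Icc] at hx
      rw [(hd x ⟨ht0.trans hx.1, hx.2⟩).deriv]
      exact div_neg_of_neg_of_pos (by linarith [mul_logRatio_lt ht0 hx.1 hx.2]) (by linarith)
    exact this ⟨le_rfl, ht1.le⟩ ⟨h.le, hs1⟩ h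

/-- The tangent bound in the variable C = √(1 - s²): the slope `concurrenceSlope / 2` decreases in
s, hence increases in C, so the corrected entropy is minimal at `t`. -/
theorem le_binEntropy_half {s t : ℝ} (ht0 : 0 < t) (ht1 : t < 1) (hs0 : 0 ≤ s) (hs1 : s ≤ 1) :
    binEntropy ((1 + t) / 2) - concurrenceSlope t / 2 * √(1 - t ^ 2) ≤
      binEntropy ((1 + s) / 2) - concurrenceSlope t / 2 * √(1 - s ^ 2) := by
  set K : ℝ → ℝ := fun x => binEntropy ((1 + x) / 2) - concurrenceSlope t / 2 * √(1 - x ^ 2)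
    with hK
  have hd : ∀ x ∈ Ioo (0 : ℝ) 1,
      HasDerivAt K (x / (2 * √(1 - x ^ 2)) * (concurrenceSlope t - concurrenceSlope x)) x := by
    rintro x ⟨h0, h1⟩
    have hp : 0 < 1 - x ^ 2 := by nlinarith
    have hr : HasDerivAt (fun x : ℝ => √(1 - x ^ 2)) (-(2 * x) / (2 * √(1 - x ^ 2))) x := by
      have := ((hasDerivAt_pow 2 x).const_sub 1).sqrt hp.ne'
      simpa using this
    have := (hasDerivAt_binEntropy_half h0 h1).sub (hr.const_mul (concurrenceSlope t / 2))
    refine this.congr_deriv ?_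
    have hq : √(1 - x ^ 2) ≠ 0 := (Real.sqrt_pos.2 hp).ne'
    rw [concurrenceSlope.eq_def x]
    field_simp
    ring
  have hc : Continuous K := by
    have := binEntropy_continuous
    fun_prop
  rcases le_total s t with h | h
  · have : AntitoneOn K (Icc 0 t) := by
      refine antitoneOn_of_deriv_nonpos (convex_Icc 0 t) hc.continuousOn ?_ ?_
      · intro x hx
        rw [interior_Icc] at hx
        exact (hd x ⟨hx.1, hx.2.trans ht1⟩).differentiableAt.differentiableWithinAt
      intro x hx
      rw [interior_Icc] at hx
      rw [(hd x ⟨hx.1, hx.2.trans ht1⟩).deriv]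
      have := antitoneOn_concurrenceSlope ⟨hx.1, hx.2.trans ht1⟩ ⟨ht0, ht1⟩ hx.2.le
      have hx0 := hx.1
      exact mul_nonpos_of_nonneg_of_nonpos (by positivity) (by linarith)
    exact this ⟨hs0, h⟩ ⟨ht0.le, le_rfl⟩ h
  · have : MonotoneOn K (Icc t 1) := by
      refine monotoneOn_of_deriv_nonneg (convex_Icc t 1) hc.continuousOn ?_ ?_
      · intro x hx
        rw [interior_Icc] at hx
        exact (hd x ⟨ht0.trans hx.1, hx.2⟩).differentiableAt.differentiableWithinAt
      intro x hx
      rw [interior_Icc] at hx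
      rw [(hd x ⟨ht0.trans hx.1, hx.2⟩).deriv]
      have := antitoneOn_concurrenceSlope ⟨ht0, ht1⟩ ⟨ht0.trans hx.1, hx.2⟩ hx.1.le
      have hx0 := ht0.trans hx.1
      exact mul_nonneg (by positivity) (by linarith)
    exact this ⟨le_rfl, ht1.le⟩ ⟨h, hs1⟩ h

theorem h_eq_binEntropy (x : ℝ) : h x = binEntropy x / log 2 := by
  simp only [h, binEntropy, logb, log_inv]
  ring

/-- The entropy of entanglement of a two-qubit pure state of concurrence `c`. -/
def concurrenceEntropy (c : ℝ) : ℝ := h ((1 + √(1 - c ^ 2)) / 2)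

theorem concurrenceEntropy_nonneg {c : ℝ} : 0 ≤ concurrenceEntropy c := by
  rw [concurrenceEntropy, h_eq_binEntropy]
  have h1 : √(1 - c ^ 2) ≤ 1 := Real.sqrt_le_one.2 (by nlinarith [sq_nonneg c])
  have h0 := Real.sqrt_nonneg (1 - c ^ 2)
  exact div_nonneg (binEntropy_nonneg (by linarith) (by linarith)) (log_pos one_lt_two).le

theorem sqrt_five_ninths : √(1 - (2 / 3 : ℝ) ^ 2) = √5 / 3 := by
  rw [show (1 - (2 / 3 : ℝ) ^ 2) = 5 / 3 ^ 2 by norm_num, Real.sqrt_div (by norm_num),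
    Real.sqrt_sq (by norm_num)]

theorem cMax_eq : cMax = 3 * concurrenceEntropy (2 / 3) := by
  rw [cMax, concurrenceEntropy, sqrt_five_ninths]
  congr 2
  ring

/-- Tangent bounds for `concurrenceEntropy` at `2 / 3`, from its strict concavity in the squared
concurrence. -/
theorem exists_concurrenceEntropy_le : ∃ k : ℝ, 0 < k ∧ ∀ c : ℝ, 0 ≤ c → c ≤ 1 →
    concurrenceEntropy c ≤ concurrenceEntropy (2 / 3) + k * (c ^ 2 - 4 / 9) ∧
    (concurrenceEntropy c = concurrenceEntropy (2 / 3) + k * (c ^ 2 - 4 / 9) → c = 2 / 3) := by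
  set t : ℝ := √(1 - (2 / 3 : ℝ) ^ 2) with ht
  have ht0 : 0 < t := Real.sqrt_pos.2 (by norm_num)
  have htsq : t ^ 2 = 5 / 9 := by rw [ht, Real.sq_sqrt (by norm_num)]; norm_num
  have ht1 : t < 1 := by nlinarith
  have hl : 0 < log 2 := log_pos one_lt_two
  have hL := two_mul_lt_logRatio ht0 ht1
  set κ := logRatio t / (4 * t) with hκ
  have hκ0 : 0 < κ := div_pos (by linarith) (by linarith)
  refine ⟨κ / log 2, div_pos hκ0 hl, fun c h0 h1 => ?_⟩
  by_cases hc : c = 2 / 3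
  · subst hc
    norm_num
  · have hsq : √(1 - c ^ 2) ^ 2 = 1 - c ^ 2 := Real.sq_sqrt (by nlinarith)
    have hne : √(1 - c ^ 2) ≠ t := by
      intro he
      rw [he, htsq] at hsq
      exact hc (by nlinarith)
    have hlt := binEntropy_half_lt ht0 ht1 (Real.sqrt_nonneg (1 - c ^ 2))
      (Real.sqrt_le_one.2 (by nlinarith)) hne
    rw [hsq, htsq, ← hκ] at hlt
    have : concurrenceEntropy c < concurrenceEntropy (2 / 3) + κ / log 2 * (c ^ 2 - 4 / 9) := by
      rw [concurrenceEntropy, concurrenceEntropy, h_eq_binEntropy, h_eq_binEntropy, ← ht,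
        div_mul_eq_mul_div, ← add_div]
      gcongr
      linarith
    exact ⟨this.le, fun he => absurd he this.ne⟩

/-- Tangent bound for `concurrenceEntropy` at `2 / 3`, from its convexity in the concurrence. -/
theorem exists_le_concurrenceEntropy : ∃ k : ℝ, 0 ≤ k ∧ ∀ c : ℝ, 0 ≤ c → c ≤ 1 →
    concurrenceEntropy (2 / 3) + k * (c - 2 / 3) ≤ concurrenceEntropy c := by
  set t : ℝ := √(1 - (2 / 3 : ℝ) ^ 2) with ht
  have ht0 : 0 < t := Real.sqrt_pos.2 (by norm_num)
  have htsq : t ^ 2 = 5 / 9 := by rw [ht, Real.sq_sqrt (by norm_num)]; norm_num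
  have ht1 : t < 1 := by nlinarith
  have hl : 0 < log 2 := log_pos one_lt_two
  have hL := two_mul_lt_logRatio ht0 ht1
  have hκ0 : 0 ≤ concurrenceSlope t / 2 := by
    have : 0 ≤ logRatio t := by linarith
    rw [concurrenceSlope]
    positivity
  refine ⟨concurrenceSlope t / 2 / log 2, by positivity, fun c h0 h1 => ?_⟩
  have hsq : √(1 - c ^ 2) ^ 2 = 1 - c ^ 2 := Real.sq_sqrt (by nlinarith)
  have hle := le_binEntropy_half ht0 ht1 (Real.sqrt_nonneg (1 - c ^ 2))
    (Real.sqrt_le_one.2 (by nlinarith))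
  rw [hsq, htsq, sub_sub_cancel, Real.sqrt_sq h0,
    show (1 - 5 / 9 : ℝ) = (2 / 3) ^ 2 by norm_num, Real.sqrt_sq (by norm_num)] at hle
  rw [concurrenceEntropy, concurrenceEntropy, h_eq_binEntropy, h_eq_binEntropy, ← ht,
    div_mul_eq_mul_div, ← add_div]
  gcongr
  linarith

end BinaryEntropy

/-! ### Pure states of two qubits and unitary mixing of pairs of vectors -/

section TwoQubit

open Matrix ComplexConjugate ComplexOrder

theorem ofReal_norm_sq (z : ℂ) : ((‖z‖ : ℂ)) ^ 2 = z * conj z := by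
  rw [Complex.mul_conj, Complex.normSq_eq_norm_sq]
  push_cast
  rfl

theorem proj_apply {X : Type*} (v : X → ℂ) (x y : X) : proj v x y = v x * conj (v y) := rfl

/-- The squared norm of a vector. -/
def normSum {X : Type*} [Fintype X] (v : X → ℂ) : ℝ := ∑ x, ‖v x‖ ^ 2

theorem normSum_nonneg {X : Type*} [Fintype X] (v : X → ℂ) : 0 ≤ normSum v :=
  Finset.sum_nonneg fun _ _ => by positivity

theorem trace_proj {X : Type*} [Fintype X] (v : X → ℂ) : (proj v).trace = (normSum v : ℂ) := by
  simp only [Matrix.trace, diag, proj_apply, normSum]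
  push_cast
  exact Finset.sum_congr rfl fun x _ => (ofReal_norm_sq _).symm

theorem proj_smul {X : Type*} (z : ℂ) (v : X → ℂ) :
    proj (z • v) = ((‖z‖ ^ 2 : ℝ) : ℂ) • proj v := by
  ext x y
  simp only [proj_apply, Pi.smul_apply, smul_eq_mul, map_mul, Matrix.smul_apply,
    Complex.ofReal_pow, ofReal_norm_sq]
  ring

theorem normSum_smul {X : Type*} [Fintype X] (z : ℂ) (v : X → ℂ) :
    normSum (z • v) = ‖z‖ ^ 2 * normSum v := by
  simp [normSum, mul_pow, Finset.mul_sum]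

theorem proj_rotate {X : Type*} (v w : X → ℂ) {a b : ℂ} (hab : a * conj a + b * conj b = 1) :
    proj (a • v + b • w) + proj (-conj b • v + conj a • w) = proj v + proj w := by
  ext x y
  simp only [proj_apply, Pi.add_apply, Pi.smul_apply, smul_eq_mul, Matrix.add_apply, map_add,
    map_mul, Complex.conj_conj, map_neg]
  linear_combination (v x * conj (v y) + w x * conj (w y)) * hab

theorem normSum_rotate {X : Type*} [Fintype X] (v w : X → ℂ) {a b : ℂ}
    (hab : a * conj a + b * conj b = 1) :
    normSum (a • v + b • w) + normSum (-conj b • v + conj a • w) = normSum v + normSum w := by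
  have := congrArg Matrix.trace (proj_rotate v w hab)
  simp only [trace_add, trace_proj] at this
  exact_mod_cast this

theorem norm_sq_rotate (x y : ℂ) {a b : ℂ} (hab : a * conj a + b * conj b = 1) :
    ‖a * x + b * y‖ ^ 2 + ‖-conj b * x + conj a * y‖ ^ 2 = ‖x‖ ^ 2 + ‖y‖ ^ 2 := by
  apply Complex.ofReal_injective
  push_cast
  simp only [ofReal_norm_sq, map_add, map_mul, map_neg, Complex.conj_conj]
  linear_combination (x * conj x + y * conj y) * hab

/-- The symmetric bilinear form polarizing twice the determinant of the coefficient matrix. -/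
def detForm (v w : Idx2 → ℂ) : ℂ :=
  v (0, 0) * w (1, 1) + v (1, 1) * w (0, 0) - v (0, 1) * w (1, 0) - v (1, 0) * w (0, 1)

theorem detForm_comm (v w : Idx2 → ℂ) : detForm v w = detForm w v := by
  simp only [detForm]; ring

theorem detForm_add_smul (u v w : Idx2 → ℂ) (a b : ℂ) :
    detForm u (a • v + b • w) = a * detForm u v + b * detForm u w := by
  simp only [detForm, Pi.add_apply, Pi.smul_apply, smul_eq_mul]; ring

theorem detForm_self_add_smul (v w : Idx2 → ℂ) (a b : ℂ) :
    detForm (a • v + b • w) (a • v + b • w) =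
      a ^ 2 * detForm v v + 2 * a * b * detForm v w + b ^ 2 * detForm w w := by
  simp only [detForm, Pi.add_apply, Pi.smul_apply, smul_eq_mul]; ring

theorem detForm_smul_smul (v w : Idx2 → ℂ) (a b : ℂ) :
    detForm (a • v) (b • w) = a * b * detForm v w := by
  simp only [detForm, Pi.smul_apply, smul_eq_mul]; ring

theorem sum_idx2 {M : Type*} [AddCommMonoid M] (f : Idx2 → M) :
    ∑ x, f x = f (0, 0) + f (0, 1) + (f (1, 0) + f (1, 1)) := by
  simp [Fintype.sum_prod_type, Fin.sum_univ_two]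

theorem norm_detForm_self_le (v : Idx2 → ℂ) : ‖detForm v v‖ ≤ normSum v := by
  have h : detForm v v = 2 * (v (0, 0) * v (1, 1)) - 2 * (v (0, 1) * v (1, 0)) := by
    simp only [detForm]; ring
  rw [h, normSum, sum_idx2]
  refine (norm_sub_le _ _).trans ?_
  simp only [norm_mul, Complex.norm_ofNat]
  nlinarith [sq_nonneg (‖v (0, 0)‖ - ‖v (1, 1)‖), sq_nonneg (‖v (0, 1)‖ - ‖v (1, 0)‖)]

theorem det_reduced (v : Idx2 → ℂ) :
    (reduced v).det = ((‖detForm v v‖ ^ 2 / 4 : ℝ) : ℂ) := by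
  rw [det_fin_two]
  push_cast
  rw [ofReal_norm_sq]
  simp only [reduced, traceOutSnd, proj_apply, Matrix.of_apply, Fin.sum_univ_two, detForm,
    map_add, map_sub, map_mul]
  ring

theorem trace_reduced (v : Idx2 → ℂ) : (reduced v).trace = (normSum v : ℂ) := by
  rw [← trace_proj]
  simp [reduced, traceOutSnd, Matrix.trace, Fintype.sum_prod_type, Fin.sum_univ_two]

theorem pureConcurrence_eq {v : Idx2 → ℂ} (hv : IsUnitVec v) :
    pureConcurrence v = ‖detForm v v‖ := by
  have ht := trace_reduced v
  have hd := det_reduced v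
  rw [show normSum v = 1 from hv] at ht
  rw [trace_fin_two] at ht
  rw [det_fin_two] at hd
  have : (reduced v * reduced v).trace = ((1 - ‖detForm v v‖ ^ 2 / 2 : ℝ) : ℂ) := by
    rw [trace_fin_two]
    simp only [Matrix.mul_apply, Fin.sum_univ_two]
    push_cast at hd ht ⊢
    linear_combination (reduced v 0 0 + reduced v 1 1 + 1) * ht - 2 * hd
  rw [pureConcurrence, this, Complex.ofReal_re,
    show 2 * (1 - (1 - ‖detForm v v‖ ^ 2 / 2)) = ‖detForm v v‖ ^ 2 by ring,
    Real.sqrt_sq (norm_nonneg _)]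

theorem pureEoF_eq {v : Idx2 → ℂ} (hv : IsUnitVec v) :
    pureEoF v = concurrenceEntropy ‖detForm v v‖ := by
  have hr := reduced_isHermitian v
  have ht := hr.trace_eq_sum_eigenvalues
  have hd := hr.det_eq_prod_eigenvalues
  rw [trace_reduced, show normSum v = 1 from hv, Fin.sum_univ_two] at ht
  rw [det_reduced, Fin.prod_univ_two] at hd
  rw [pureEoF, vonNeumannEntropy, Fin.sum_univ_two, concurrenceEntropy]
  set x := (reduced_isHermitian v).eigenvalues 0
  set y := (reduced_isHermitian v).eigenvalues 1
  have ht' : 1 = x + y := Complex.ofReal_injective (by push_cast; exact ht)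
  have hd' : ‖detForm v v‖ ^ 2 / 4 = x * y := Complex.ofReal_injective (by rw [hd]; push_cast; rfl)
  have hy : y = 1 - x := by linarith
  -- The eigenvalues have sum 1 and product C²/4, so 1 - C² is the square of their difference. Their
  -- order is irrelevant since h(x) = h(1 - x).
  rw [show 1 - ‖detForm v v‖ ^ 2 = (2 * x - 1) ^ 2 by rw [hy] at hd'; linarith, Real.sqrt_sq_eq_abs,
    h, hy]
  rcases abs_cases (2 * x - 1) with ⟨h1, -⟩ | ⟨h1, -⟩ <;> rw [h1]
  · rw [show (1 + (2 * x - 1)) / 2 = x by ring]; ring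
  · rw [show (1 + -(2 * x - 1)) / 2 = 1 - x by ring, show 1 - (1 - x) = x by ring]; ring

theorem norm_detForm_self_le_one {v : Idx2 → ℂ} (hv : IsUnitVec v) : ‖detForm v v‖ ≤ 1 :=
  (norm_detForm_self_le v).trans_eq hv

theorem exists_unit_isotropic (x y z : ℂ) :
    ∃ a b : ℂ, a * conj a + b * conj b = 1 ∧ a ^ 2 * x + 2 * a * b * y + b ^ 2 * z = 0 := by
  obtain ⟨a, b, h0, hq⟩ : ∃ a b : ℂ, 0 < ‖a‖ ^ 2 + ‖b‖ ^ 2 ∧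
      a ^ 2 * x + 2 * a * b * y + b ^ 2 * z = 0 := by
    by_cases hx : x = 0
    · exact ⟨1, 0, by simp, by simp [hx]⟩
    · obtain ⟨s, hs⟩ := IsAlgClosed.exists_pow_nat_eq (y ^ 2 - x * z) two_pos
      refine ⟨(-y + s) / x, 1, by rw [norm_one]; positivity, ?_⟩
      field_simp
      linear_combination hs
  set r := √(‖a‖ ^ 2 + ‖b‖ ^ 2) with hr
  have hr0 : (r : ℂ) ≠ 0 := by exact_mod_cast (Real.sqrt_pos.2 h0).ne'
  have hr2 : (r : ℂ) ^ 2 = a * conj a + b * conj b := by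
    rw [← ofReal_norm_sq, ← ofReal_norm_sq, ← Complex.ofReal_pow, hr, Real.sq_sqrt h0.le]
    push_cast
    ring
  refine ⟨a / r, b / r, ?_, ?_⟩
  · simp only [map_div₀, Complex.conj_ofReal]
    field_simp
    rw [hr2]
  · field_simp
    linear_combination hq

/-! ### The unitary invariant of a rank-two state -/

/-- The squared concurrence of `|v⟩⟨v| + |w⟩⟨w|`, in terms of the Gram matrix of `detForm`. -/
def sqConcurrence (v w : Idx2 → ℂ) : ℝ :=
  ‖detForm v v‖ ^ 2 + 2 * ‖detForm v w‖ ^ 2 + ‖detForm w w‖ ^ 2 -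
    2 * ‖detForm v v * detForm w w - detForm v w ^ 2‖

theorem sqConcurrence_rotate (v w : Idx2 → ℂ) {a b : ℂ} (hab : a * conj a + b * conj b = 1) :
    sqConcurrence (a • v + b • w) (-conj b • v + conj a • w) = sqConcurrence v w := by
  set v' := a • v + b • w with hv'
  set w' := -conj b • v + conj a • w with hw'
  have hd : detForm v' v' * detForm w' w' - detForm v' w' ^ 2 =
      detForm v v * detForm w w - detForm v w ^ 2 := by
    rw [hv', hw', detForm_self_add_smul, detForm_self_add_smul, detForm_add_smul,
      detForm_comm (a • v + b • w) v, detForm_comm (a • v + b • w) w, detForm_add_smul,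
      detForm_add_smul, detForm_comm w v]
    linear_combination (detForm v v * detForm w w - detForm v w ^ 2) *
      (a * conj a + b * conj b + 1) * hab
  -- Unitary mixing preserves the norm of each row of the Gram matrix; using this for `v`, `w`,
  -- `v'`, `w'` in turn gives invariance of its Frobenius norm.
  have key : ∀ u : Idx2 → ℂ, ‖detForm u v'‖ ^ 2 + ‖detForm u w'‖ ^ 2 =
      ‖detForm u v‖ ^ 2 + ‖detForm u w‖ ^ 2 := fun u => by
    rw [hv', hw', detForm_add_smul, detForm_add_smul, norm_sq_rotate _ _ hab]
  rw [sqConcurrence, sqConcurrence, hd]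
  have h1 := key v
  have h2 := key w
  have h3 := key v'
  have h4 := key w'
  rw [detForm_comm w' v', detForm_comm w' v, detForm_comm w' w] at h4
  rw [detForm_comm v' v, detForm_comm v' w] at h3
  rw [detForm_comm w v] at h2
  linarith

/-- With a zero diagonal entry the determinant has modulus |`detForm v w`|², which cancels the
off-diagonal contribution. -/
theorem sqConcurrence_of_isotropic {v w : Idx2 → ℂ} (hv : detForm v v = 0) :
    sqConcurrence v w = ‖detForm w w‖ ^ 2 := by
  simp [sqConcurrence, hv]

/-- Rotating a pair of vectors so that the first one becomes a product vector. -/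
theorem exists_rotate_isotropic (v w : Idx2 → ℂ) : ∃ a b : ℂ, a * conj a + b * conj b = 1 ∧
    detForm (a • v + b • w) (a • v + b • w) = 0 := by
  obtain ⟨a, b, hab, h0⟩ := exists_unit_isotropic (detForm v v) (detForm v w) (detForm w w)
  exact ⟨a, b, hab, by rw [detForm_self_add_smul, h0]⟩

/-! ### Lower bound for the average concurrence -/

theorem dotProduct_proj_mulVec {X : Type*} [Fintype X] (s t v : X → ℂ) :
    s ⬝ᵥ (proj v *ᵥ star t) = (s ⬝ᵥ v) * conj (t ⬝ᵥ v) := by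
  rw [proj, vecMulVec_mulVec, dotProduct_smul, starRingEnd_apply, star_dotProduct]
  simp

theorem IsDecomposition.sum_mul_conj {X : Type*} [Fintype X] {v w : X → ℂ} {n : ℕ} {p : Fin n → ℝ}
    {φ : Fin n → X → ℂ} (hd : IsDecomposition (proj v + proj w) p φ) (s t : X → ℂ) :
    ∑ i, (p i : ℂ) * ((s ⬝ᵥ φ i) * conj (t ⬝ᵥ φ i)) =
      (s ⬝ᵥ v) * conj (t ⬝ᵥ v) + (s ⬝ᵥ w) * conj (t ⬝ᵥ w) := by
  have h := congrArg (fun M => s ⬝ᵥ (M *ᵥ star t)) hd.2.2.2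
  simp only [add_mulVec, dotProduct_add, dotProduct_proj_mulVec, sum_mulVec, dotProduct_sum,
    smul_mulVec, dotProduct_smul, smul_eq_mul] at h
  exact h.symm

/-- A linear form vanishing on `v` and `w` has zero second moment over the decomposition, so it
kills every vector of nonzero weight. -/
theorem IsDecomposition.mem_span {X : Type*} [Fintype X] [DecidableEq X] {v w : X → ℂ} {n : ℕ}
    {p : Fin n → ℝ} {φ : Fin n → X → ℂ} (hd : IsDecomposition (proj v + proj w) p φ) {i : Fin n}
    (hi : p i ≠ 0) : ∃ a b : ℂ, φ i = a • v + b • w := by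
  suffices φ i ∈ Submodule.span ℂ {v, w} by
    obtain ⟨a, b, h⟩ := Submodule.mem_span_pair.1 this
    exact ⟨a, b, h.symm⟩
  by_contra hmem
  obtain ⟨f, hf, hle⟩ := Submodule.exists_le_ker_of_notMem hmem
  set s : X → ℂ := (dotProductEquiv ℂ X).symm f with hs
  have hsf : ∀ u, s ⬝ᵥ u = f u := fun u => by
    rw [← LinearEquiv.apply_symm_apply (dotProductEquiv ℂ X) f]; rfl
  have hv : s ⬝ᵥ v = 0 := by rw [hsf]; exact hle (Submodule.subset_span (by simp))
  have hw : s ⬝ᵥ w = 0 := by rw [hsf]; exact hle (Submodule.subset_span (by simp))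
  have h := hd.sum_mul_conj s s
  simp only [hv, hw, zero_mul, add_zero, ← ofReal_norm_sq] at h
  have h' : ∑ j, p j * ‖s ⬝ᵥ φ j‖ ^ 2 = 0 := by exact_mod_cast h
  rw [Finset.sum_eq_zero_iff_of_nonneg
    (fun j _ => mul_nonneg (hd.1 j) (by positivity))] at h'
  have := h' i (Finset.mem_univ i)
  simp [hi, hsf, hf] at this

/-- The vector representing the linear form `detForm v`. -/
def detDual (v : Idx2 → ℂ) : Idx2 → ℂ := fun x =>
  if x.1 = x.2 then v (1 - x.1, 1 - x.2) else -v (1 - x.1, 1 - x.2)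

theorem detDual_dotProduct (v w : Idx2 → ℂ) : detDual v ⬝ᵥ w = detForm v w := by
  simp [dotProduct, sum_idx2, detDual, detForm]
  ring

/-- A decomposition of `|v⟩⟨v| + |w⟩⟨w|` with `v` a product vector has average concurrence at least
that of `w`. -/
theorem IsDecomposition.norm_detForm_le {v w : Idx2 → ℂ} (hv : detForm v v = 0) {n : ℕ}
    {p : Fin n → ℝ} {φ : Fin n → Idx2 → ℂ} (hd : IsDecomposition (proj v + proj w) p φ) :
    ‖detForm w w‖ ≤ ∑ i, p i * ‖detForm (φ i) (φ i)‖ := by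
  have hp := hd.1
  by_cases hw : detForm w w = 0
  · rw [hw, norm_zero]
    exact Finset.sum_nonneg fun i _ => mul_nonneg (hp i) (norm_nonneg _)
  have hex : ∀ i, ∃ a b : ℂ, p i ≠ 0 → φ i = a • v + b • w := fun i => by
    by_cases hi : p i = 0
    · exact ⟨0, 0, fun h => absurd hi h⟩
    · obtain ⟨a, b, h⟩ := hd.mem_span hi
      exact ⟨a, b, fun _ => h⟩
  choose a b hab using hex
  set β := detForm v w with hβ
  set δ := detForm w w with hδ
  have hsum := fun s t : Idx2 → ℂ => hd.sum_mul_conj (detDual s) (detDual t)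
  simp only [detDual_dotProduct] at hsum
  have hev : ∀ i, p i ≠ 0 → detForm v (φ i) = b i * β := fun i hi => by
    rw [hab i hi, detForm_add_smul, hv]; ring
  have hew : ∀ i, p i ≠ 0 → detForm w (φ i) = a i * β + b i * δ := fun i hi => by
    rw [hab i hi, detForm_add_smul, detForm_comm w v]
  have hew2 : ∀ i, p i ≠ 0 → detForm (φ i) (φ i) = 2 * a i * b i * β + b i ^ 2 * δ :=
    fun i hi => by rw [hab i hi, detForm_self_add_smul, hv]; ring
  have hcongr : ∀ f g : Fin n → ℂ, (∀ i, p i ≠ 0 → f i = g i) →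
      ∑ i, (p i : ℂ) * f i = ∑ i, (p i : ℂ) * g i := fun f g hfg =>
    Finset.sum_congr rfl fun i _ => by
      by_cases hi : p i = 0
      · simp [hi]
      · rw [hfg i hi]
  -- For independent `v`, `w` the coefficients satisfy ∑ p |b|² = 1 and ∑ p a b̄ = 0. Testing only
  -- against the forms `detForm v` and `detForm w` yields what is needed without assuming
  -- independence: if β = 0 the cross term is multiplied by zero anyway.
  have hcross : β * ∑ i, (p i : ℂ) * (a i * conj (b i)) = 0 ∧
      ∑ i, (p i : ℂ) * (b i * conj (b i)) = 1 := by
    by_cases hb : β = 0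
    · refine ⟨by simp [hb], ?_⟩
      have h := hsum w w
      rw [hcongr _ (fun i => (b i * conj (b i)) * (δ * conj δ)) (fun i hi => by
        rw [hew i hi, hb]; simp only [map_mul, mul_zero, zero_add]; ring)] at h
      simp only [← mul_assoc, ← Finset.sum_mul] at h
      rw [detForm_comm w v, ← hβ, hb] at h
      have hc : conj δ ≠ 0 := by simpa using hw
      simp only [zero_mul, zero_add] at h
      have h2 := mul_right_cancel₀ hc h
      have h3 := mul_right_cancel₀ hw (h2.trans (one_mul δ).symm)
      simpa only [mul_assoc] using h3
    · have hc : conj β ≠ 0 := by simpa using hb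
      have h1 : ∑ i, (p i : ℂ) * (b i * conj (b i)) = 1 := by
        have h := hsum v v
        rw [hcongr _ (fun i => (b i * conj (b i)) * (β * conj β)) (fun i hi => by
          rw [hev i hi]; simp only [map_mul]; ring)] at h
        simp only [← mul_assoc, ← Finset.sum_mul] at h
        rw [hv, ← hβ] at h
        simp only [zero_mul, zero_add] at h
        have h2 := mul_right_cancel₀ hc h
        have h3 := mul_right_cancel₀ hb (h2.trans (one_mul β).symm)
        simpa only [mul_assoc] using h3
      refine ⟨?_, h1⟩
      have h := hsum w v
      rw [hcongr _ (fun i => (a i * conj (b i)) * (β * conj β) +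
        (b i * conj (b i)) * (δ * conj β)) (fun i hi => by
          rw [hev i hi, hew i hi]; simp only [map_mul]; ring)] at h
      simp only [mul_add, Finset.sum_add_distrib] at h
      simp only [← mul_assoc, ← Finset.sum_mul] at h
      simp only [mul_assoc] at h h1 ⊢
      rw [hv, map_zero, mul_zero, zero_add, h1, ← hβ, ← hδ] at h
      have : conj β * (β * ∑ i, (p i : ℂ) * (a i * conj (b i))) = 0 := by
        linear_combination h
      exact (mul_eq_zero.1 this).resolve_left hc
  have hδ0 : 0 < ‖δ‖ := norm_pos_iff.2 hw
  -- The modulus of `detForm (φ i) (φ i)` is at least its real part after rotation by the phase of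
  -- conj(δ b²). In the sum over i the cross terms vanish by `hcross`.
  have hterm : ∀ i, p i * (‖δ‖ ^ 2 * ‖b i‖ ^ 2 +
      (2 * conj δ * β * (a i * conj (b i))).re) ≤ ‖δ‖ * (p i * ‖detForm (φ i) (φ i)‖) := fun i => by
    by_cases hi : p i = 0
    · simp [hi]
    rw [mul_left_comm ‖δ‖]
    refine mul_le_mul_of_nonneg_left ?_ (hp i)
    rw [hew2 i hi]
    by_cases hb : b i = 0
    · simp [hb]
    have hb0 : 0 < ‖b i‖ ^ 2 := by positivity
    refine le_of_mul_le_mul_right ?_ hb0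
    calc (‖δ‖ ^ 2 * ‖b i‖ ^ 2 + (2 * conj δ * β * (a i * conj (b i))).re) * ‖b i‖ ^ 2
        = (((2 * a i * b i * β + b i ^ 2 * δ) * (conj δ * conj (b i) ^ 2))).re := by
          rw [show (2 * a i * b i * β + b i ^ 2 * δ) * (conj δ * conj (b i) ^ 2) =
            (((‖δ‖ ^ 2 * ‖b i‖ ^ 2 : ℝ) : ℂ) + 2 * conj δ * β * (a i * conj (b i))) *
              ((‖b i‖ ^ 2 : ℝ) : ℂ) by
            push_cast; rw [ofReal_norm_sq, ofReal_norm_sq]; ring, Complex.re_mul_ofReal,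
            Complex.add_re, Complex.ofReal_re]
      _ ≤ ‖(2 * a i * b i * β + b i ^ 2 * δ) * (conj δ * conj (b i) ^ 2)‖ := Complex.re_le_norm _
      _ = ‖δ‖ * ‖2 * a i * b i * β + b i ^ 2 * δ‖ * ‖b i‖ ^ 2 := by
          rw [norm_mul, norm_mul, norm_pow, Complex.norm_conj, Complex.norm_conj]; ring
  have htot := Finset.sum_le_sum fun i (_ : i ∈ Finset.univ) => hterm i
  rw [← Finset.mul_sum] at htot
  have hlhs : ∑ i, p i * (‖δ‖ ^ 2 * ‖b i‖ ^ 2 + (2 * conj δ * β * (a i * conj (b i))).re) =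
      ‖δ‖ ^ 2 := by
    have h1 : ∑ i, p i * ‖b i‖ ^ 2 = 1 := by
      have := hcross.2
      simp only [← ofReal_norm_sq] at this
      exact_mod_cast this
    have h2 : ∑ i, p i * (2 * conj δ * β * (a i * conj (b i))).re = 0 := by
      have : (2 * conj δ * (β * ∑ i, (p i : ℂ) * (a i * conj (b i)))).re = 0 := by
        rw [hcross.1]; simp
      rw [← this, Finset.mul_sum, Finset.mul_sum, Complex.re_sum]
      refine Finset.sum_congr rfl fun i _ => ?_
      rw [← Complex.re_ofReal_mul]
      congr 1
      ring
    have h3 : ∑ i, p i * (‖δ‖ ^ 2 * ‖b i‖ ^ 2) = ‖δ‖ ^ 2 * ∑ i, p i * ‖b i‖ ^ 2 := by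
      rw [Finset.mul_sum]
      exact Finset.sum_congr rfl fun i _ => by ring
    simp only [mul_add, Finset.sum_add_distrib]
    rw [h2, h3, h1]
    ring
  rw [hlhs, sq] at htot
  exact le_of_mul_le_mul_left htot hδ0

/-! ### Convex roofs and optimal decompositions -/

theorem convexRoof_le {X ι : Type*} [Fintype X] [Fintype ι] {F : (X → ℂ) → ℝ}
    (hF : ∀ φ, IsUnitVec φ → 0 ≤ F φ) {p : ι → ℝ} {φ : ι → X → ℂ} (hp : ∀ i, 0 ≤ p i)
    (hp1 : ∑ i, p i = 1) (hφ : ∀ i, IsUnitVec (φ i)) {ρ : Matrix X X ℂ}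
    (hρ : ρ = ∑ i, (p i : ℂ) • proj (φ i)) : convexRoof F ρ ≤ ∑ i, p i * F (φ i) := by
  refine csInf_le ⟨0, ?_⟩ ?_
  · rintro x ⟨n, q, χ, hd, rfl⟩
    exact Finset.sum_nonneg fun i _ => mul_nonneg (hd.1 i) (hF _ (hd.2.2.1 i))
  · let e := (Fintype.equivFin ι).symm
    refine ⟨Fintype.card ι, p ∘ e, φ ∘ e, ⟨fun i => hp _, ?_, fun i => hφ _, ?_⟩, ?_⟩
    · rw [← hp1]; exact e.sum_comp p
    · rw [hρ]; exact (e.sum_comp fun i => (p i : ℂ) • proj (φ i)).symm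
    · exact (e.sum_comp fun i => p i * F (φ i)).symm

/-- A decomposition is required because the real infimum of the empty set is 0. -/
theorem le_convexRoof {X : Type*} [Fintype X] {F : (X → ℂ) → ℝ} {ρ : Matrix X X ℂ} {n : ℕ}
    {p : Fin n → ℝ} {φ : Fin n → X → ℂ} (hd : IsDecomposition ρ p φ) {c : ℝ}
    (hc : ∀ (m : ℕ) (q : Fin m → ℝ) (χ : Fin m → X → ℂ), IsDecomposition ρ q χ →
      c ≤ ∑ i, q i * F (χ i)) : c ≤ convexRoof F ρ := by
  refine le_csInf ⟨_, n, p, φ, hd, rfl⟩ ?_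
  rintro x ⟨m, q, χ, hχ, rfl⟩
  exact hc m q χ hχ

theorem exists_phase (z : ℂ) : ∃ e : ℂ, ‖e‖ = 1 ∧ e ^ 2 * z = (‖z‖ : ℂ) := by
  refine ⟨Complex.exp (((-z.arg / 2 : ℝ) : ℂ) * Complex.I), Complex.norm_exp_ofReal_mul_I _, ?_⟩
  have h : Complex.exp (((-z.arg / 2 : ℝ) : ℂ) * Complex.I) ^ 2 *
      Complex.exp (z.arg * Complex.I) = 1 := by
    rw [← Complex.exp_nat_mul, ← Complex.exp_add, ← Complex.exp_zero]
    congr 1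
    push_cast
    ring
  linear_combination (‖z‖ : ℂ) * h -
    Complex.exp (((-z.arg / 2 : ℝ) : ℂ) * Complex.I) ^ 2 * Complex.norm_mul_exp_arg_mul_I z

theorem normSum_add_eq_one_of_proj {X : Type*} [Fintype X] {v w v' w' : X → ℂ}
    (h : proj v' + proj w' = proj v + proj w) :
    normSum v' + normSum w' = normSum v + normSum w := by
  have := congrArg Matrix.trace h
  simp only [trace_add, trace_proj] at this
  exact_mod_cast this

/-- With real Gram entries, a real rotation by θ keeps `detForm` real. The defect `f` of the desired
proportionality takes opposite values at θ and θ + π/2, since both the form values and the norms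
have fixed sums; the intermediate value theorem gives a common zero. -/
theorem exists_balanced_of_real {v w : Idx2 → ℂ} {b d : ℝ} (hv : detForm v v = 0)
    (hb : detForm v w = b) (hd : detForm w w = d) (hd0 : 0 ≤ d)
    (hN : normSum v + normSum w = 1) :
    ∃ v' w' : Idx2 → ℂ, proj v' + proj w' = proj v + proj w ∧
      ‖detForm v' v'‖ = d * normSum v' ∧ ‖detForm w' w'‖ = d * normSum w' := by
  set y : ℝ → Idx2 → ℂ := fun θ => ((Real.cos θ : ℝ) : ℂ) • v + ((Real.sin θ : ℝ) : ℂ) • w with hy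
  set Q : ℝ → ℝ := fun θ => 2 * Real.cos θ * Real.sin θ * b + Real.sin θ ^ 2 * d with hQ
  have hQy : ∀ θ, detForm (y θ) (y θ) = (Q θ : ℂ) := fun θ => by
    simp only [hy, hQ]
    rw [detForm_self_add_smul, hv, hb, hd]
    push_cast
    ring
  have hproj : ∀ θ, proj (y θ) + proj (y (θ + Real.pi / 2)) = proj v + proj w := fun θ => by
    rw [← proj_rotate v w (a := ((Real.cos θ : ℝ) : ℂ)) (b := ((Real.sin θ : ℝ) : ℂ))]
    · simp only [hy, Real.cos_add_pi_div_two, Real.sin_add_pi_div_two, Complex.conj_ofReal,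
        Complex.ofReal_neg]
    · rw [Complex.conj_ofReal, Complex.conj_ofReal]
      exact_mod_cast (by nlinarith [Real.sin_sq_add_cos_sq θ] :
        Real.cos θ * Real.cos θ + Real.sin θ * Real.sin θ = 1)
  have hnorm : ∀ θ, normSum (y θ) + normSum (y (θ + Real.pi / 2)) = 1 := fun θ =>
    (normSum_add_eq_one_of_proj (hproj θ)).trans hN
  have hQsum : ∀ θ, Q θ + Q (θ + Real.pi / 2) = d := fun θ => by
    simp only [hQ, Real.cos_add_pi_div_two, Real.sin_add_pi_div_two]
    linear_combination d * Real.sin_sq_add_cos_sq θ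
  set f : ℝ → ℝ := fun θ => Q θ - d * normSum (y θ) with hf
  have hfsum : ∀ θ, f θ + f (θ + Real.pi / 2) = 0 := fun θ => by
    simp only [hf]
    linear_combination hQsum θ - d * hnorm θ
  have hcont : Continuous f := by
    simp only [hf, hQ, hy, normSum, Pi.add_apply, Pi.smul_apply]
    fun_prop
  obtain ⟨θ, hθ⟩ : ∃ θ, f θ = 0 := by
    have h0 := hfsum 0
    rcases le_total (f 0) 0 with h | h
    · exact mem_range_of_exists_le_of_exists_ge hcont ⟨0, h⟩ ⟨0 + Real.pi / 2, by linarith⟩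
    · exact mem_range_of_exists_le_of_exists_ge hcont ⟨0 + Real.pi / 2, by linarith⟩ ⟨0, h⟩
  have hgood : ∀ θ, f θ = 0 → ‖detForm (y θ) (y θ)‖ = d * normSum (y θ) := fun θ hθ => by
    have : Q θ = d * normSum (y θ) := by simp only [hf] at hθ; linarith
    rw [hQy, this, Complex.norm_real, Real.norm_eq_abs,
      abs_of_nonneg (mul_nonneg hd0 (normSum_nonneg _))]
  exact ⟨y θ, y (θ + Real.pi / 2), hproj θ, hgood θ hθ, hgood _ (by linarith [hfsum θ])⟩

theorem proj_smul_of_norm_eq_one {X : Type*} {z : ℂ} (hz : ‖z‖ = 1) (v : X → ℂ) :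
    proj (z • v) = proj v := by
  rw [proj_smul, hz]; simp

theorem exists_balanced_of_isotropic {v w : Idx2 → ℂ} (hv : detForm v v = 0)
    (hN : normSum v + normSum w = 1) :
    ∃ v' w' : Idx2 → ℂ, proj v' + proj w' = proj v + proj w ∧
      ‖detForm v' v'‖ = ‖detForm w w‖ * normSum v' ∧
      ‖detForm w' w'‖ = ‖detForm w w‖ * normSum w' := by
  obtain ⟨e, he, he2⟩ := exists_phase (detForm w w)
  -- Phases on `v` and `w` leave the state fixed. `e` makes `detForm w w` real; then `v` is
  -- multiplied by `g ^ 2` to make the mixed entry real, its own form value being zero.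
  obtain ⟨g, hg, hg2⟩ := exists_phase (e * detForm v w)
  have hg2' : ‖g ^ 2‖ = 1 := by rw [norm_pow, hg, one_pow]
  obtain ⟨v', w', h1, h2⟩ := exists_balanced_of_real (v := g ^ 2 • v) (w := e • w)
    (b := ‖e * detForm v w‖) (d := ‖detForm w w‖)
    (by rw [detForm_smul_smul, hv, mul_zero])
    (by rw [detForm_smul_smul, mul_assoc, hg2])
    (by rw [detForm_smul_smul, ← sq, he2]) (norm_nonneg _)
    (by rw [normSum_smul, normSum_smul, hg2', he]; linarith)
  rw [proj_smul_of_norm_eq_one hg2', proj_smul_of_norm_eq_one he] at h1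
  exact ⟨v', w', h1, h2⟩

theorem sqConcurrence_bounds {v w : Idx2 → ℂ} (hN : normSum v + normSum w = 1) :
    0 ≤ sqConcurrence v w ∧ sqConcurrence v w ≤ 1 := by
  obtain ⟨a, b, hab, h0⟩ := exists_rotate_isotropic v w
  have hr := normSum_rotate v w hab
  rw [← sqConcurrence_rotate v w hab, sqConcurrence_of_isotropic h0]
  have h1 := norm_detForm_self_le (-conj b • v + conj a • w)
  have h2 := normSum_nonneg (a • v + b • w)
  have h3 := norm_nonneg (detForm (-conj b • v + conj a • w) (-conj b • v + conj a • w))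
  exact ⟨by positivity, by nlinarith⟩

theorem exists_balanced {v w : Idx2 → ℂ} (hN : normSum v + normSum w = 1) :
    ∃ v' w' : Idx2 → ℂ, proj v' + proj w' = proj v + proj w ∧
      ‖detForm v' v'‖ = √(sqConcurrence v w) * normSum v' ∧
      ‖detForm w' w'‖ = √(sqConcurrence v w) * normSum w' := by
  obtain ⟨a, b, hab, h0⟩ := exists_rotate_isotropic v w
  rw [← sqConcurrence_rotate v w hab, sqConcurrence_of_isotropic h0,
    Real.sqrt_sq (norm_nonneg _), ← proj_rotate v w hab]
  exact exists_balanced_of_isotropic h0 ((normSum_rotate v w hab).trans hN)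

theorem isUnitVec_single {X : Type*} [Fintype X] [DecidableEq X] (x : X) :
    IsUnitVec (Pi.single x (1 : ℂ)) := by
  rw [IsUnitVec, Finset.sum_eq_single x]
  · simp
  · intro y _ hy
    simp [Pi.single_eq_of_ne hy]
  · simp

theorem exists_normalize {X : Type*} [Fintype X] [DecidableEq X] [Nonempty X] (v : X → ℂ) :
    ∃ φ : X → ℂ, IsUnitVec φ ∧ v = ((√(normSum v) : ℝ) : ℂ) • φ := by
  by_cases h : normSum v = 0
  -- The zero vector is assigned an arbitrary unit vector; it will carry weight zero.
  · obtain ⟨x⟩ := ‹Nonempty X›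
    refine ⟨Pi.single x 1, isUnitVec_single x, ?_⟩
    rw [h, Real.sqrt_zero, Complex.ofReal_zero, zero_smul]
    ext y
    have := (Finset.sum_eq_zero_iff_of_nonneg (fun y _ => by positivity)).1 h y (Finset.mem_univ y)
    simpa using this
  · have hpos : 0 < normSum v := lt_of_le_of_ne (normSum_nonneg v) (Ne.symm h)
    have hs : 0 < √(normSum v) := Real.sqrt_pos.2 hpos
    refine ⟨((√(normSum v))⁻¹ : ℝ) • v, ?_, ?_⟩
    · change normSum _ = 1
      rw [← Complex.coe_smul, normSum_smul, Complex.norm_real, norm_inv, Real.norm_eq_abs,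
        abs_of_pos hs, inv_pow, Real.sq_sqrt hpos.le, inv_mul_cancel₀ h]
    · rw [Complex.coe_smul, smul_inv_smul₀ (ne_of_gt hs)]

/-- The Wootters decomposition: `|v⟩⟨v| + |w⟩⟨w|` is a mixture of two pure states of concurrence
`√(sqConcurrence v w)`. -/
theorem exists_isDecomposition {v w : Idx2 → ℂ} (hN : normSum v + normSum w = 1) :
    ∃ (p : Fin 2 → ℝ) (φ : Fin 2 → Idx2 → ℂ), IsDecomposition (proj v + proj w) p φ ∧
      ∀ i, p i ≠ 0 → ‖detForm (φ i) (φ i)‖ = √(sqConcurrence v w) := by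
  obtain ⟨v', w', hp, hv, hw⟩ := exists_balanced hN
  have hN' := (normSum_add_eq_one_of_proj hp).trans hN
  obtain ⟨χ, hχ, hvχ⟩ := exists_normalize v'
  obtain ⟨ω, hω, hwω⟩ := exists_normalize w'
  have hproj : ∀ u χ : Idx2 → ℂ, u = ((√(normSum u) : ℝ) : ℂ) • χ →
      proj u = ((normSum u : ℝ) : ℂ) • proj χ := fun u χ hu => by
    conv_lhs => rw [hu]
    rw [proj_smul, Complex.norm_real, Real.norm_eq_abs, sq_abs, Real.sq_sqrt (normSum_nonneg u)]
  have hdet : ∀ u χ : Idx2 → ℂ, u = ((√(normSum u) : ℝ) : ℂ) • χ → normSum u ≠ 0 →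
      ‖detForm u u‖ = √(sqConcurrence v w) * normSum u →
      ‖detForm χ χ‖ = √(sqConcurrence v w) := fun u χ hu h0 hd => by
    have : ‖detForm u u‖ = normSum u * ‖detForm χ χ‖ := by
      conv_lhs => rw [hu]
      rw [detForm_smul_smul, norm_mul, ← sq, norm_pow, Complex.norm_real, Real.norm_eq_abs,
        sq_abs, Real.sq_sqrt (normSum_nonneg u)]
    rw [this, mul_comm] at hd
    exact mul_right_cancel₀ h0 hd
  refine ⟨![normSum v', normSum w'], ![χ, ω], ⟨?_, ?_, ?_, ?_⟩, ?_⟩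
  · simp [Fin.forall_fin_two, normSum_nonneg]
  · simpa [Fin.sum_univ_two] using hN'
  · simp [Fin.forall_fin_two, hχ, hω]
  · rw [← hp, Fin.sum_univ_two, hproj v' χ hvχ, hproj w' ω hwω]
    rfl
  · rw [Fin.forall_fin_two]
    exact ⟨fun h => hdet v' χ hvχ h hv, fun h => hdet w' ω hwω h hw⟩

/-- Concatenating the optimal decompositions of the components gives a decomposition of the mixture.
A general `F` covers both concurrence and entanglement of formation. -/
theorem convexRoof_le_of_mixture {ι : Type*} [Fintype ι] {F : (Idx2 → ℂ) → ℝ} {G : ℝ → ℝ}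
    (hF : ∀ φ, IsUnitVec φ → 0 ≤ F φ) (hFG : ∀ φ, IsUnitVec φ → F φ = G ‖detForm φ φ‖)
    {l : ι → ℝ} (hl : ∀ i, 0 ≤ l i) (hl1 : ∑ i, l i = 1) {v w : ι → Idx2 → ℂ}
    (hN : ∀ i, normSum (v i) + normSum (w i) = 1) :
    convexRoof F (∑ i, (l i : ℂ) • (proj (v i) + proj (w i))) ≤
      ∑ i, l i * G (√(sqConcurrence (v i) (w i))) := by
  choose p φ hd hG using fun i => exists_isDecomposition (hN i)
  have hval : ∑ x : ι × Fin 2, (l x.1 * p x.1 x.2) * F (φ x.1 x.2) =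
      ∑ i, l i * G (√(sqConcurrence (v i) (w i))) := by
    rw [Fintype.sum_prod_type]
    refine Finset.sum_congr rfl fun i _ => ?_
    rw [← mul_one (l i * G _), ← (hd i).2.1, Finset.mul_sum]
    refine Finset.sum_congr rfl fun j _ => ?_
    by_cases hp : p i j = 0
    · simp [hp]
    · rw [hFG _ ((hd i).2.2.1 j), hG i j hp]
      ring
  rw [← hval]
  refine convexRoof_le (p := fun x : ι × Fin 2 => l x.1 * p x.1 x.2)
    (φ := fun x => φ x.1 x.2) hF (fun x => mul_nonneg (hl _) ((hd _).1 _)) ?_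
    (fun x => (hd _).2.2.1 _) ?_
  · rw [Fintype.sum_prod_type, ← hl1]
    refine Finset.sum_congr rfl fun i _ => ?_
    change ∑ j, l i * p i j = l i
    rw [← Finset.mul_sum, (hd i).2.1, mul_one]
  · rw [Fintype.sum_prod_type]
    refine Finset.sum_congr rfl fun i _ => ?_
    rw [(hd i).2.2.2, Finset.smul_sum]
    refine Finset.sum_congr rfl fun j _ => ?_
    rw [smul_smul]
    push_cast
    rfl

theorem convexRoof_le_of_pair {F : (Idx2 → ℂ) → ℝ} {G : ℝ → ℝ}
    (hF : ∀ φ, IsUnitVec φ → 0 ≤ F φ) (hFG : ∀ φ, IsUnitVec φ → F φ = G ‖detForm φ φ‖)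
    {v w : Idx2 → ℂ} (hN : normSum v + normSum w = 1) :
    convexRoof F (proj v + proj w) ≤ G (√(sqConcurrence v w)) := by
  have := convexRoof_le_of_mixture (ι := Unit) hF hFG (l := fun _ => 1) (v := fun _ => v)
    (w := fun _ => w) (by simp) (by simp) (fun _ => hN)
  simpa using this

theorem pureEoF_nonneg {φ : Idx2 → ℂ} (hφ : IsUnitVec φ) : 0 ≤ pureEoF φ := by
  rw [pureEoF_eq hφ]; exact concurrenceEntropy_nonneg

theorem IsDecomposition.sqrt_sqConcurrence_le {v w : Idx2 → ℂ} {n : ℕ} {p : Fin n → ℝ}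
    {φ : Fin n → Idx2 → ℂ} (hd : IsDecomposition (proj v + proj w) p φ) :
    √(sqConcurrence v w) ≤ ∑ i, p i * ‖detForm (φ i) (φ i)‖ := by
  obtain ⟨a, b, hab, h0⟩ := exists_rotate_isotropic v w
  rw [← proj_rotate v w hab] at hd
  rw [← sqConcurrence_rotate v w hab, sqConcurrence_of_isotropic h0, Real.sqrt_sq (norm_nonneg _)]
  exact hd.norm_detForm_le h0

theorem concurrence_eq {v w : Idx2 → ℂ} (hN : normSum v + normSum w = 1) :
    concurrence (proj v + proj w) = √(sqConcurrence v w) := by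
  refine le_antisymm (convexRoof_le_of_pair (G := id) (fun φ _ => Real.sqrt_nonneg _)
    (fun φ hφ => pureConcurrence_eq hφ) hN) ?_
  obtain ⟨p, φ, hd, -⟩ := exists_isDecomposition hN
  refine le_convexRoof hd fun m q χ hχ => ?_
  simp only [pureConcurrence_eq (hχ.2.2.1 _)]
  exact hχ.sqrt_sqConcurrence_le

theorem eof_le {v w : Idx2 → ℂ} (hN : normSum v + normSum w = 1) :
    eof (proj v + proj w) ≤ concurrenceEntropy (√(sqConcurrence v w)) :=
  convexRoof_le_of_pair (fun _ => pureEoF_nonneg) (fun _ => pureEoF_eq) hN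

/-- Jensen's inequality through the tangent at 2/3, whose slope is nonnegative, applied to an
average concurrence of at least 2/3. -/
theorem le_eof {v w : Idx2 → ℂ} (hN : normSum v + normSum w = 1)
    (hc : sqConcurrence v w = 4 / 9) : concurrenceEntropy (2 / 3) ≤ eof (proj v + proj w) := by
  obtain ⟨p, φ, hd, -⟩ := exists_isDecomposition hN
  obtain ⟨k, hk, htan⟩ := exists_le_concurrenceEntropy
  refine le_convexRoof hd fun m q χ hχ => ?_
  have hlow := hχ.sqrt_sqConcurrence_le
  rw [hc, show (4 / 9 : ℝ) = (2 / 3) ^ 2 by norm_num, Real.sqrt_sq (by norm_num)] at hlow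
  calc concurrenceEntropy (2 / 3)
      ≤ concurrenceEntropy (2 / 3) + k * (∑ i, q i * ‖detForm (χ i) (χ i)‖ - 2 / 3) := by
        have := mul_nonneg hk (sub_nonneg.2 hlow)
        linarith
    _ = ∑ i, q i * (concurrenceEntropy (2 / 3) + k * (‖detForm (χ i) (χ i)‖ - 2 / 3)) := by
        have h1 : ∀ i, q i * (concurrenceEntropy (2 / 3) + k * (‖detForm (χ i) (χ i)‖ - 2 / 3)) =
          q i * (concurrenceEntropy (2 / 3) - k * (2 / 3)) +
            k * (q i * ‖detForm (χ i) (χ i)‖) := fun i => by ring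
        simp only [h1, Finset.sum_add_distrib, ← Finset.sum_mul, ← Finset.mul_sum, hχ.2.1]
        ring
    _ ≤ ∑ i, q i * pureEoF (χ i) := by
        refine Finset.sum_le_sum fun i _ => mul_le_mul_of_nonneg_left ?_ (hχ.1 i)
        rw [pureEoF_eq (hχ.2.2.1 i)]
        exact htan _ (norm_nonneg _) (norm_detForm_self_le_one (hχ.2.2.1 i))

/-! ### Three-qubit pure states and the bound 4/3 -/

/-- The component of a three-qubit vector along `|c⟩` of the third qubit. -/
def sliceAB (ψ : Idx3 → ℂ) (c : Fin 2) : Idx2 → ℂ := fun x => ψ (x.1, x.2, c)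

/-- The component of a three-qubit vector along `|b⟩` of the second qubit. -/
def sliceAC (ψ : Idx3 → ℂ) (b : Fin 2) : Idx2 → ℂ := fun x => ψ (x.1, b, x.2)

/-- The component of a three-qubit vector along `|a⟩` of the first qubit. -/
def sliceBC (ψ : Idx3 → ℂ) (a : Fin 2) : Idx2 → ℂ := fun x => ψ (a, x.1, x.2)

theorem margAB_proj (ψ : Idx3 → ℂ) :
    margAB (proj ψ) = proj (sliceAB ψ 0) + proj (sliceAB ψ 1) := by
  ext x y
  simp [margAB, proj_apply, sliceAB, Fin.sum_univ_two]

theorem margAC_proj (ψ : Idx3 → ℂ) :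
    margAC (proj ψ) = proj (sliceAC ψ 0) + proj (sliceAC ψ 1) := by
  ext x y
  simp [margAC, proj_apply, sliceAC, Fin.sum_univ_two]

theorem margBC_proj (ψ : Idx3 → ℂ) :
    margBC (proj ψ) = proj (sliceBC ψ 0) + proj (sliceBC ψ 1) := by
  ext x y
  simp [margBC, proj_apply, sliceBC, Fin.sum_univ_two]

theorem sum_idx3 {M : Type*} [AddCommMonoid M] (f : Idx3 → M) :
    ∑ x, f x = f (0, 0, 0) + f (0, 0, 1) + (f (0, 1, 0) + f (0, 1, 1)) +
      (f (1, 0, 0) + f (1, 0, 1) + (f (1, 1, 0) + f (1, 1, 1))) := by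
  simp [Fintype.sum_prod_type, Fin.sum_univ_two]

theorem normSum_sliceAB {ψ : Idx3 → ℂ} (hψ : IsUnitVec ψ) :
    normSum (sliceAB ψ 0) + normSum (sliceAB ψ 1) = 1 := by
  rw [← hψ, sum_idx3, normSum, normSum, sum_idx2, sum_idx2]
  simp only [sliceAB]
  ring

theorem normSum_sliceAC {ψ : Idx3 → ℂ} (hψ : IsUnitVec ψ) :
    normSum (sliceAC ψ 0) + normSum (sliceAC ψ 1) = 1 := by
  rw [← hψ, sum_idx3, normSum, normSum, sum_idx2, sum_idx2]
  simp only [sliceAC]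
  ring

theorem normSum_sliceBC {ψ : Idx3 → ℂ} (hψ : IsUnitVec ψ) :
    normSum (sliceBC ψ 0) + normSum (sliceBC ψ 1) = 1 := by
  rw [← hψ, sum_idx3, normSum, normSum, sum_idx2, sum_idx2]
  simp only [sliceBC]

/-- The sum of the squared moduli of the `2 × 2` minors of a pair of vectors, each counted
twice. -/
def minorSum (v w : Idx2 → ℂ) : ℝ := ∑ x, ∑ y, ‖v x * w y - w x * v y‖ ^ 2

theorem minorSum_rotate (v w : Idx2 → ℂ) {a b : ℂ} (hab : a * conj a + b * conj b = 1) :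
    minorSum (a • v + b • w) (-conj b • v + conj a • w) = minorSum v w := by
  refine Finset.sum_congr rfl fun x _ => Finset.sum_congr rfl fun y _ => ?_
  congr 2
  simp only [Pi.add_apply, Pi.smul_apply, smul_eq_mul]
  linear_combination (v x * w y - w x * v y) * hab

/-- Lagrange's identity: the deficit is twice the squared modulus of the inner product. -/
theorem minorSum_le (v w : Idx2 → ℂ) : minorSum v w ≤ 2 * (normSum v * normSum w) := by
  have h : minorSum v w = 2 * (normSum v * normSum w) - 2 * ‖∑ x, v x * conj (w x)‖ ^ 2 := by
    apply Complex.ofReal_injective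
    simp only [minorSum, normSum]
    push_cast
    simp only [ofReal_norm_sq, sum_idx2, map_add, map_sub, map_mul, Complex.conj_conj]
    ring
  rw [h]
  have := sq_nonneg ‖∑ x, v x * conj (w x)‖
  linarith

/-- The Coffman–Kundu–Wootters identity, before subtracting the three-tangle. -/
theorem gram_sliceAB_add_sliceAC (ψ : Idx3 → ℂ) :
    (‖detForm (sliceAB ψ 0) (sliceAB ψ 0)‖ ^ 2 + 2 * ‖detForm (sliceAB ψ 0) (sliceAB ψ 1)‖ ^ 2 +
      ‖detForm (sliceAB ψ 1) (sliceAB ψ 1)‖ ^ 2) +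
    (‖detForm (sliceAC ψ 0) (sliceAC ψ 0)‖ ^ 2 + 2 * ‖detForm (sliceAC ψ 0) (sliceAC ψ 1)‖ ^ 2 +
      ‖detForm (sliceAC ψ 1) (sliceAC ψ 1)‖ ^ 2) =
    2 * minorSum (sliceBC ψ 0) (sliceBC ψ 1) := by
  apply Complex.ofReal_injective
  simp only [minorSum, detForm, sliceAB, sliceAC, sliceBC, sum_idx2]
  push_cast
  simp only [ofReal_norm_sq, map_add, map_sub, map_mul]
  ring

theorem sum_sqConcurrence_le {ψ : Idx3 → ℂ} (hψ : IsUnitVec ψ) :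
    sqConcurrence (sliceAB ψ 0) (sliceAB ψ 1) + sqConcurrence (sliceAC ψ 0) (sliceAC ψ 1) +
      sqConcurrence (sliceBC ψ 0) (sliceBC ψ 1) ≤ 4 / 3 := by
  have hckw := gram_sliceAB_add_sliceAC ψ
  -- For AB and AC the determinant term, a multiple of the three-tangle, is dropped; for BC it is
  -- kept.
  have hAB : sqConcurrence (sliceAB ψ 0) (sliceAB ψ 1) ≤
      ‖detForm (sliceAB ψ 0) (sliceAB ψ 0)‖ ^ 2 + 2 * ‖detForm (sliceAB ψ 0) (sliceAB ψ 1)‖ ^ 2 +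
      ‖detForm (sliceAB ψ 1) (sliceAB ψ 1)‖ ^ 2 := sub_le_self _ (by positivity)
  have hAC : sqConcurrence (sliceAC ψ 0) (sliceAC ψ 1) ≤
      ‖detForm (sliceAC ψ 0) (sliceAC ψ 0)‖ ^ 2 + 2 * ‖detForm (sliceAC ψ 0) (sliceAC ψ 1)‖ ^ 2 +
      ‖detForm (sliceAC ψ 1) (sliceAC ψ 1)‖ ^ 2 := sub_le_self _ (by positivity)
  obtain ⟨a, b, hab, h0⟩ := exists_rotate_isotropic (sliceBC ψ 0) (sliceBC ψ 1)
  have hN := (normSum_rotate _ _ hab).trans (normSum_sliceBC hψ)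
  rw [← minorSum_rotate _ _ hab] at hckw
  rw [← sqConcurrence_rotate (sliceBC ψ 0) _ hab, sqConcurrence_of_isotropic h0]
  set v := a • sliceBC ψ 0 + b • sliceBC ψ 1
  set w := -conj b • sliceBC ψ 0 + conj a • sliceBC ψ 1
  have h1 := minorSum_le v w
  have h2 := norm_detForm_self_le w
  have h3 := norm_nonneg (detForm w w)
  have h4 : ‖detForm w w‖ ^ 2 ≤ normSum w ^ 2 := by gcongr
  have h5 : normSum v = 1 - normSum w := by linarith
  rw [h5] at h1
  -- With p = `normSum w`: 4p(1 - p) + p² = 4/3 - 3(p - 2/3)².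
  nlinarith [sq_nonneg (normSum w - 2 / 3)]

theorem sum_concurrenceEntropy_le {x y z : ℝ} (hx : 0 ≤ x ∧ x ≤ 1) (hy : 0 ≤ y ∧ y ≤ 1)
    (hz : 0 ≤ z ∧ z ≤ 1) (hsum : x + y + z ≤ 4 / 3) :
    concurrenceEntropy √x + concurrenceEntropy √y + concurrenceEntropy √z ≤ cMax ∧
    (concurrenceEntropy √x + concurrenceEntropy √y + concurrenceEntropy √z = cMax →
      x = 4 / 9 ∧ y = 4 / 9 ∧ z = 4 / 9) := by
  obtain ⟨k, hk, hb⟩ := exists_concurrenceEntropy_le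
  have key : ∀ t : ℝ, 0 ≤ t ∧ t ≤ 1 →
      concurrenceEntropy √t ≤ concurrenceEntropy (2 / 3) + k * (t - 4 / 9) ∧
      (concurrenceEntropy √t = concurrenceEntropy (2 / 3) + k * (t - 4 / 9) → t = 4 / 9) :=
    fun t ht => by
      obtain ⟨h1, h2⟩ := hb √t (Real.sqrt_nonneg t) (Real.sqrt_le_one.2 ht.2)
      rw [Real.sq_sqrt ht.1] at h1 h2
      refine ⟨h1, fun h => ?_⟩
      rw [← Real.sq_sqrt ht.1, h2 h]
      norm_num
  obtain ⟨hx1, hx2⟩ := key x hx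
  obtain ⟨hy1, hy2⟩ := key y hy
  obtain ⟨hz1, hz2⟩ := key z hz
  have hs : k * (x + y + z - 4 / 3) ≤ 0 := mul_nonpos_of_nonneg_of_nonpos hk.le (by linarith)
  rw [cMax_eq]
  exact ⟨by linarith, fun h => ⟨hx2 (by linarith), hy2 (by linarith), hz2 (by linarith)⟩⟩

theorem eofSum_proj_le {ψ : Idx3 → ℂ} (hψ : IsUnitVec ψ) : eofSum (proj ψ) ≤ cMax := by
  have h := (sum_concurrenceEntropy_le (sqConcurrence_bounds (normSum_sliceAB hψ))
    (sqConcurrence_bounds (normSum_sliceAC hψ)) (sqConcurrence_bounds (normSum_sliceBC hψ))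
    (sum_sqConcurrence_le hψ)).1
  rw [eofSum, margAB_proj, margAC_proj, margBC_proj]
  linarith [eof_le (normSum_sliceAB hψ), eof_le (normSum_sliceAC hψ), eof_le (normSum_sliceBC hψ)]

theorem eofSum_proj_eq_iff {ψ : Idx3 → ℂ} (hψ : IsUnitVec ψ) :
    eofSum (proj ψ) = cMax ↔ sqConcurrence (sliceAB ψ 0) (sliceAB ψ 1) = 4 / 9 ∧
      sqConcurrence (sliceAC ψ 0) (sliceAC ψ 1) = 4 / 9 ∧
      sqConcurrence (sliceBC ψ 0) (sliceBC ψ 1) = 4 / 9 := by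
  constructor
  · intro h
    obtain ⟨h1, h2⟩ := sum_concurrenceEntropy_le (sqConcurrence_bounds (normSum_sliceAB hψ))
      (sqConcurrence_bounds (normSum_sliceAC hψ)) (sqConcurrence_bounds (normSum_sliceBC hψ))
      (sum_sqConcurrence_le hψ)
    refine h2 (le_antisymm h1 ?_)
    rw [← h, eofSum, margAB_proj, margAC_proj, margBC_proj]
    linarith [eof_le (normSum_sliceAB hψ), eof_le (normSum_sliceAC hψ),
      eof_le (normSum_sliceBC hψ)]
  · rintro ⟨h1, h2, h3⟩
    refine le_antisymm (eofSum_proj_le hψ) ?_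
    rw [eofSum, margAB_proj, margAC_proj, margBC_proj, cMax_eq]
    linarith [le_eof (normSum_sliceAB hψ) h1, le_eof (normSum_sliceAC hψ) h2,
      le_eof (normSum_sliceBC hψ) h3]

theorem concurrence_sq {v w : Idx2 → ℂ} (hN : normSum v + normSum w = 1) :
    concurrence (proj v + proj w) ^ 2 = sqConcurrence v w := by
  rw [concurrence_eq hN, Real.sq_sqrt (sqConcurrence_bounds hN).1]

/-! ### The W state and mixed states -/

theorem isUnitVec_wState : IsUnitVec wState := by
  have h3 : √3 ^ 2 = (3 : ℝ) := Real.sq_sqrt (by norm_num)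
  rw [IsUnitVec, sum_idx3]
  simp [wState, ket, h3]
  norm_num

theorem eofSum_wState : eofSum (proj wState) = cMax := by
  have h3 : √3 * √3 = (3 : ℝ) := Real.mul_self_sqrt (by norm_num)
  have hc : ((√3 : ℝ) : ℂ)⁻¹ * ((√3 : ℝ) : ℂ)⁻¹ = 1 / 3 := by
    rw [← mul_inv, ← Complex.ofReal_mul, h3]; norm_num
  rw [eofSum_proj_eq_iff isUnitVec_wState]
  refine ⟨?_, ?_, ?_⟩ <;>
  · simp [sqConcurrence, detForm, sliceAB, sliceAC, sliceBC, wState, ket, hc]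
    norm_num

/-- A density operator is a mixture of pure states. -/
theorem IsDensity.exists_mixture {X : Type*} [Fintype X] [DecidableEq X] {ρ : Matrix X X ℂ}
    (hρ : IsDensity ρ) : ∃ (l : X → ℝ) (ψ : X → X → ℂ), (∀ i, 0 ≤ l i) ∧ ∑ i, l i = 1 ∧
      (∀ i, IsUnitVec (ψ i)) ∧ ρ = ∑ i, (l i : ℂ) • proj (ψ i) := by
  have hH := hρ.1.isHermitian
  refine ⟨hH.eigenvalues, fun i => hH.eigenvectorBasis i, hρ.1.eigenvalues_nonneg, ?_, ?_, ?_⟩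
  · have := hH.trace_eq_sum_eigenvalues
    rw [hρ.2] at this
    exact Complex.ofReal_injective (by push_cast; exact this.symm)
  · intro i
    rw [IsUnitVec, ← EuclideanSpace.norm_sq_eq, hH.eigenvectorBasis.norm_eq_one, one_pow]
  · ext x y
    conv_lhs => rw [hH.spectral_theorem]
    rw [Unitary.conjStarAlgAut_apply, Matrix.mul_apply, Matrix.sum_apply]
    refine Finset.sum_congr rfl fun i _ => ?_
    rw [mul_diagonal, Matrix.smul_apply, proj_apply, star_apply]
    simp only [IsHermitian.eigenvectorUnitary_apply, Function.comp_apply, smul_eq_mul]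
    change _ * (hH.eigenvalues i : ℂ) * conj _ = _
    ring

theorem eofSum_le {ρ : Matrix Idx3 Idx3 ℂ} (hρ : IsDensity ρ) : eofSum ρ ≤ cMax := by
  obtain ⟨l, ψ, hl, hl1, hψ, rfl⟩ := hρ.exists_mixture
  have hAB : margAB (∑ i, (l i : ℂ) • proj (ψ i)) =
      ∑ i, (l i : ℂ) • (proj (sliceAB (ψ i) 0) + proj (sliceAB (ψ i) 1)) := by
    simp only [← margAB_proj]
    ext x y
    simp only [margAB, Matrix.of_apply, Matrix.sum_apply, Matrix.smul_apply, Finset.smul_sum]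
    exact Finset.sum_comm
  have hAC : margAC (∑ i, (l i : ℂ) • proj (ψ i)) =
      ∑ i, (l i : ℂ) • (proj (sliceAC (ψ i) 0) + proj (sliceAC (ψ i) 1)) := by
    simp only [← margAC_proj]
    ext x y
    simp only [margAC, Matrix.of_apply, Matrix.sum_apply, Matrix.smul_apply, Finset.smul_sum]
    exact Finset.sum_comm
  have hBC : margBC (∑ i, (l i : ℂ) • proj (ψ i)) =
      ∑ i, (l i : ℂ) • (proj (sliceBC (ψ i) 0) + proj (sliceBC (ψ i) 1)) := by
    simp only [← margBC_proj]
    ext x y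
    simp only [margBC, Matrix.of_apply, Matrix.sum_apply, Matrix.smul_apply, Finset.smul_sum]
    exact Finset.sum_comm
  have h1 := convexRoof_le_of_mixture (fun _ => pureEoF_nonneg) (fun _ => pureEoF_eq) hl hl1
    fun i => normSum_sliceAB (hψ i)
  have h2 := convexRoof_le_of_mixture (fun _ => pureEoF_nonneg) (fun _ => pureEoF_eq) hl hl1
    fun i => normSum_sliceAC (hψ i)
  have h3 := convexRoof_le_of_mixture (fun _ => pureEoF_nonneg) (fun _ => pureEoF_eq) hl hl1
    fun i => normSum_sliceBC (hψ i)
  rw [eofSum, hAB, hAC, hBC]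
  -- All three marginals use the same weights `l`, so the pure-state entropy bound applies
  -- eigenvector by eigenvector.
  refine (add_le_add (add_le_add h1 h2) h3).trans ?_
  rw [← Finset.sum_add_distrib, ← Finset.sum_add_distrib]
  calc _ ≤ ∑ i, l i * cMax := by
        refine Finset.sum_le_sum fun i _ => ?_
        rw [← mul_add, ← mul_add]
        exact mul_le_mul_of_nonneg_left (sum_concurrenceEntropy_le
          (sqConcurrence_bounds (normSum_sliceAB (hψ i)))
          (sqConcurrence_bounds (normSum_sliceAC (hψ i)))
          (sqConcurrence_bounds (normSum_sliceBC (hψ i))) (sum_sqConcurrence_le (hψ i))).1 (hl i)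
    _ = cMax := by rw [← Finset.sum_mul, hl1, one_mul]

end TwoQubit

end QState

end

theorem theorem1 :
    -- the bound for pure states
    (∀ ψ : QState.Idx3 → ℂ, QState.IsUnitVec ψ →
      QState.eofSum (QState.proj ψ) ≤ QState.cMax) ∧
    -- it is attained by the W state
    (QState.IsUnitVec QState.wState ∧
      QState.eofSum (QState.proj QState.wState) = QState.cMax) ∧
    -- the pure states that attain it have equal squared concurrences, namely 4/9, and conversely
    (∀ ψ : QState.Idx3 → ℂ, QState.IsUnitVec ψ →
      (QState.eofSum (QState.proj ψ) = QState.cMax ↔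
        QState.concurrence (QState.margAB (QState.proj ψ)) ^ 2 = 4 / 9 ∧
        QState.concurrence (QState.margAC (QState.proj ψ)) ^ 2 = 4 / 9 ∧
        QState.concurrence (QState.margBC (QState.proj ψ)) ^ 2 = 4 / 9)) ∧
    -- the bound for mixed states
    (∀ ρ : Matrix QState.Idx3 QState.Idx3 ℂ, QState.IsDensity ρ →
      QState.eofSum ρ ≤ QState.cMax) := by
  refine ⟨fun ψ hψ => QState.eofSum_proj_le hψ,
    ⟨QState.isUnitVec_wState, QState.eofSum_wState⟩, fun ψ hψ => ?_,
    fun ρ hρ => QState.eofSum_le hρ⟩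
  rw [QState.margAB_proj, QState.margAC_proj, QState.margBC_proj,
    QState.concurrence_sq (QState.normSum_sliceAB hψ),
    QState.concurrence_sq (QState.normSum_sliceAC hψ),
    QState.concurrence_sq (QState.normSum_sliceBC hψ)]
  exact QState.eofSum_proj_eq_iff hψ
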